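/- Let $KS_0$ be the boundary of the equilateral triangle in $\mathbb{C}$ with vertices $0,1,e^{i\pi/3}$, and let $KS_{n+1}$ be obtained from the polygon $KS_n$ by replacing the middle third of each of its $3\cdot 4^n$ sides by the other two sides of the equilateral triangle erected outwards on it (the prefractal approximations of the Koch snowflake). Let $\Omega(KS_n)$ be the compact region bounded by $KS_n$. Directions $\theta\in S^1$ are measured in the fixed frame of the plane. A direction $\theta$ is inward pointing at $x\in KS_n$ if $x+t\theta$ lies in the interior of $\Omega(KS_n)$ for all sufficiently small $t>0$. The billiard map $f_n$ of $\Omega(KS_n)$ acts on pairs $(x,\theta)$ with $x\in KS_n$ and $\theta$ inward pointing at $x$. It sends $(x,\theta)$ to $(y,\varphi)$, where $y=x+t\theta$ ($t>0$) is the first point of $KS_n$ hit by the ball, and $\varphi$ is the inward pointing direction at $y$ equivalent to $\theta$ under the group generated by the reflections in the sides of $KS_n$ that contain $y$. It is undefined when $y$ is a vertex at which equivalent inward pointing directions need not be equal, that is, a vertex with interior angle $4\pi/3$; at vertices with interior angle $\pi/3$ it is defined. The orbit $\mathscr{O}_n(x,\theta)$ consists of all forward and backward iterates of $(x,\theta)$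 under $f_n$, as far as they are defined; it is called closed if it is a finite set (so singular closed orbits are allowed). Let $(x_n^0,\theta_n^0)_{n\ge 0}$ be such that for every $n\ge 0$: $x_n^0\in KS_n$ and $\theta_n^0$ is inward pointing at $x_n^0$ with respect to $\Omega(KS_n)$; $\theta_n^0=\theta_0^0$; $x_n^0\in x_0^0+\mathbb{R}\,\theta_0^0$; and no point of $KS_n$ lies strictly between $x_0^0$ and $x_n^0$. (The orbits $\mathscr{O}_n(x_n^0,\theta_n^0)$ are then said to form a compatible sequence of orbits.) Theorem. If $\mathscr{O}_0(x_0^0,\theta_0^0)$ is a closed orbit of $\Omega(KS_0)$, then for every $n\ge 0$ the orbit $\mathscr{O}_n(x_n^0,\theta_n^0)$ is a closed orbit of $\Omega(KS_n)$. -/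

import Mathlib

noncomputable section

/-- The apex `e^{iπ/3}` of the equilateral triangle with base `[0,1]`. -/
def kochApex : ℂ := ⟨1 / 2, Real.sqrt 3 / 2⟩

/-- The first trisection point of the oriented segment from `s.1` to `s.2`. -/
def kochFirst (s : ℂ × ℂ) : ℂ := s.1 + (s.2 - s.1) / 3

/-- The second trisection point of the oriented segment from `s.1` to `s.2`. -/
def kochSecond (s : ℂ × ℂ) : ℂ := s.1 + 2 * (s.2 - s.1) / 3

/-- The tip of the equilateral triangle erected on the middle third of the oriented segment
from `s.1` to `s.2`, on its right-hand side (which is the outer side for a counterclockwise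
polygon). -/
def kochTip (s : ℂ × ℂ) : ℂ :=
  kochFirst s + (s.2 - s.1) / 3 * (starRingEnd ℂ) kochApex

/-- The `3 * 4 ^ n` sides of the `n`-th (inner) prefractal approximation of the Koch snowflake,
oriented counterclockwise. The initial triangle has vertices `0`, `1` and `e^{iπ/3}`; in each step
the middle third of every side is replaced by the two other sides of the equilateral triangle
erected on it outwards. -/
def kochSides : ℕ → Set (ℂ × ℂ)
  | 0 => {(0, 1), (1, kochApex), (kochApex, 0)}
  | n + 1 => ⋃ s ∈ kochSides n,
      {(s.1, kochFirst s), (kochFirst s, kochTip s), (kochTip s, kochSecond s),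
        (kochSecond s, s.2)}

/-- The prefractal curve `KS_n`, the union of its sides. -/
def kochCurve (n : ℕ) : Set ℂ := ⋃ s ∈ kochSides n, segment ℝ s.1 s.2

/-- The billiard table `Ω(KS_n)`, the compact region bounded by `KS_n`: the initial triangle with
an equilateral triangle glued to the middle third of every side in each step. -/
def kochTable : ℕ → Set ℂ
  | 0 => convexHull ℝ {0, 1, kochApex}
  | n + 1 => kochTable n ∪
      ⋃ s ∈ kochSides n, convexHull ℝ {kochFirst s, kochTip s, kochSecond s}

/-- The direction `θ`, measured in the fixed frame of the plane, points at `x` into the interior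
of the table `Ω(KS_n)`. -/
def IsInward (n : ℕ) (x : ℂ) (θ : Circle) : Prop :=
  ∃ ε > (0 : ℝ), ∀ t ∈ Set.Ioo (0 : ℝ) ε, x + (t : ℂ) * (θ : ℂ) ∈ interior (kochTable n)

/-- A point of the phase space of `Ω(KS_n)`, given by its inward pointing representative:
a basepoint on `KS_n` and an inward pointing direction. -/
def IsPhasePoint (n : ℕ) (p : ℂ × Circle) : Prop :=
  p.1 ∈ kochCurve n ∧ IsInward n p.1 p.2

/-- The group generated by the (linear) reflections in the sides of `KS_n` containing `x`.
It has order two if `x` is not a vertex; at a vertex it is generated by the reflections in the two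
adjacent sides. -/
def reflectionGroup (n : ℕ) (x : ℂ) : Subgroup (ℂ ≃ₗᵢ[ℝ] ℂ) :=
  Subgroup.closure {r | ∃ s ∈ kochSides n, x ∈ segment ℝ s.1 s.2 ∧
    r = (Submodule.span ℝ {s.2 - s.1}).reflection}

/-- The identification `(x, θ) ∼ (x, φ)` of directions at a point `x` of `KS_n`. -/
def DirEquiv (n : ℕ) (x : ℂ) (θ φ : Circle) : Prop :=
  ∃ g ∈ reflectionGroup n x, g (θ : ℂ) = (φ : ℂ)

/-- Reflection at the point `x` of `KS_n` is well defined: equivalent inward pointing directions at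
`x` are equal. This holds if `x` is not a vertex and at the vertices with interior angle `π/3`
(removable singularities); it fails at the vertices with interior angle `4π/3`. -/
def ReflectionDefined (n : ℕ) (x : ℂ) : Prop :=
  ∀ φ ψ : Circle, IsInward n x φ → IsInward n x ψ → DirEquiv n x φ ψ → φ = ψ

/-- `y` is the first point of `KS_n` that a ball starting at `p.1` in the direction `p.2` hits. -/
def IsFirstCollision (n : ℕ) (p : ℂ × Circle) (y : ℂ) : Prop :=
  ∃ t > (0 : ℝ), y = p.1 + (t : ℂ) * (p.2 : ℂ) ∧ y ∈ kochCurve n ∧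
    ∀ s ∈ Set.Ioo (0 : ℝ) t, p.1 + (s : ℂ) * (p.2 : ℂ) ∉ kochCurve n

/-- The graph of the billiard map `f_n` of `Ω(KS_n)`: the ball starting at `p` first hits `KS_n`
at `q.1`, and `q.2` is the inward pointing direction at `q.1` that is identified with the
direction of incidence `p.2`. The map is not defined if the ball runs into a vertex at which
reflection is not defined. -/
def BilliardMap (n : ℕ) (p q : ℂ × Circle) : Prop :=
  IsPhasePoint n p ∧ IsPhasePoint n q ∧ IsFirstCollision n p q.1 ∧
    ReflectionDefined n q.1 ∧ DirEquiv n q.1 p.2 q.2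

/-- The (Poincaré section of the) orbit of `p` in `Ω(KS_n)`: all forward and backward iterates
of `p` under the billiard map, as far as they are defined. -/
def billiardOrbit (n : ℕ) (p : ℂ × Circle) : Set (ℂ × Circle) :=
  {q | Relation.ReflTransGen (BilliardMap n) p q ∨ Relation.ReflTransGen (BilliardMap n) q p}

/-- The orbit of `p` in `Ω(KS_n)` is closed: its Poincaré section is finite. So it is either
periodic, or singular and confined between vertices of `KS_n` in both directions of time. -/
def IsClosedOrbit (n : ℕ) (p : ℂ × Circle) : Prop := (billiardOrbit n p).Finite

/-- `p n` is, for every `n`, the initial condition of an orbit of `Ω(KS_n)`, and these orbits form a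
compatible sequence: all initial directions agree in the fixed frame, the basepoint of `p n` is
collinear with that of `p 0` in this direction, and no point of `KS_n` lies strictly between the
two basepoints. -/
def IsCompatibleSequence (p : ℕ → ℂ × Circle) : Prop :=
  ∀ n, IsPhasePoint n (p n) ∧ (p n).2 = (p 0).2 ∧
    (∃ t : ℝ, (p n).1 = (p 0).1 + (t : ℂ) * ((p 0).2 : ℂ)) ∧
    ∀ z ∈ kochCurve n, ¬ Sbtw ℝ (p 0).1 z (p n).1

end

open ComplexConjugate

/-! Call a direction rational if some positive multiple of it is an Eisenstein integer. The theorem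
splits in two: a closed orbit of the triangle has a rational direction, and in a rational direction
every orbit of every `KS_n` is closed. Compatible orbits share their direction, so the two halves
fit together.

Both halves rest on unfolding. The sides of `KS_n` are edges of the triangular grid of mesh `3⁻ⁿ`
(`kochSides_spec`), so each bounce is a symmetry of that grid with linear part in a dihedral group
of order six (`reflectionGroup_spec`), and an orbit is a straight line modulo such symmetries
(`Unfolds`).

In the triangle the billiard map never stops, since the `π/3` corners are removable
(`exists_billiardMap_zero`). A finite orbit thus repeats a state, and the grid symmetry closing it
up yields a lattice vector along the flight (`IsRationalDirection.of_unfolds_self`). Conversely, the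
grid translates of a line in a rational direction form a discrete family, so they cut each of the
finitely many sides transversally in finitely many points (`finite_hittingPoints`). Only finitely
many directions occur, so the orbit is finite. -/

/-! ### Eisenstein integers and cube roots of unity. -/

theorem kochApex_mul_self : kochApex * kochApex = kochApex - 1 := by
  apply Complex.ext <;> simp [kochApex] <;>
    nlinarith [Real.sq_sqrt (show (0:ℝ) ≤ 3 by norm_num)]

/-- The ring of Eisenstein integers, spanned by `1` and `e^{iπ/3}`. -/
def eisenstein : Subring ℂ where
  carrier := {z | ∃ a b : ℤ, z = a + b * kochApex}
  one_mem' := ⟨1, 0, by simp⟩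
  zero_mem' := ⟨0, 0, by simp⟩
  add_mem' := by
    rintro _ _ ⟨a, b, rfl⟩ ⟨c, d, rfl⟩
    exact ⟨a + c, b + d, by push_cast; ring⟩
  neg_mem' := by
    rintro _ ⟨a, b, rfl⟩
    exact ⟨-a, -b, by push_cast; ring⟩
  mul_mem' := by
    rintro _ _ ⟨a, b, rfl⟩ ⟨c, d, rfl⟩
    exact ⟨a * c - b * d, a * d + b * c + b * d, by
      push_cast; linear_combination (b * d : ℂ) * kochApex_mul_self⟩

theorem conj_kochApex : conj kochApex = 1 - kochApex := by
  apply Complex.ext <;> simp [kochApex]; norm_num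

theorem kochApex_mem : kochApex ∈ eisenstein := ⟨0, 1, by simp⟩

theorem conj_mem_eisenstein {z : ℂ} (hz : z ∈ eisenstein) : conj z ∈ eisenstein := by
  obtain ⟨a, b, rfl⟩ := hz
  exact ⟨a + b, -b, by simp [conj_kochApex]; ring⟩

theorem im_eisenstein {z : ℂ} (hz : z ∈ eisenstein) : ∃ m : ℤ, z.im = m * (Real.sqrt 3 / 2) := by
  obtain ⟨a, b, rfl⟩ := hz
  exact ⟨b, by simp [kochApex]⟩

theorem cube_root_cases {u : ℂ} (hu : u ^ 3 = 1) : u = 1 ∨ u = kochApex - 1 ∨ u = -kochApex := by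
  have h : (u - 1) * ((u - (kochApex - 1)) * (u + kochApex)) = 0 := by
    linear_combination hu - (u - 1) * kochApex_mul_self
  rcases mul_eq_zero.1 h with h | h
  · exact Or.inl (sub_eq_zero.1 h)
  rcases mul_eq_zero.1 h with h | h
  · exact Or.inr (Or.inl (sub_eq_zero.1 h))
  · exact Or.inr (Or.inr (eq_neg_of_add_eq_zero_left h))

theorem cube_root_mem {u : ℂ} (hu : u ^ 3 = 1) : u ∈ eisenstein := by
  rcases cube_root_cases hu with rfl | rfl | rfl
  · exact one_mem _
  · exact sub_mem kochApex_mem (one_mem _)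
  · exact neg_mem kochApex_mem

/-! ### The dihedral group of order six and the grids it preserves. -/

theorem conj_mul_self_of_pow_eq_one {u : ℂ} {k : ℕ} (hk : k ≠ 0) (hu : u ^ k = 1) :
    conj u * u = 1 := by
  rw [Complex.conj_mul', Complex.norm_eq_one_of_pow_eq_one hu hk]; simp

/-- The dihedral group of order six, generated by the reflections in the sides of an
equilateral triangle with a horizontal side. -/
def dihedralThree : Subgroup (ℂ ≃ₗᵢ[ℝ] ℂ) where
  carrier := {g | ∃ u : ℂ, u ^ 3 = 1 ∧ ((∀ z, g z = u * z) ∨ ∀ z, g z = u * conj z)}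
  one_mem' := ⟨1, by simp, Or.inl fun z => by simp⟩
  mul_mem' := by
    rintro g h ⟨u, hu, hg⟩ ⟨v, hv, hh⟩
    have hv' : (conj v) ^ 3 = 1 := by rw [← map_pow, hv, map_one]
    rcases hg with hg | hg <;> rcases hh with hh | hh
    · exact ⟨u * v, by rw [mul_pow, hu, hv, one_mul], Or.inl fun z => by simp [hg, hh]; ring⟩
    · exact ⟨u * v, by rw [mul_pow, hu, hv, one_mul], Or.inr fun z => by simp [hg, hh]; ring⟩
    · exact ⟨u * conj v, by rw [mul_pow, hu, hv', one_mul],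
        Or.inr fun z => by simp [hg, hh]; ring⟩
    · exact ⟨u * conj v, by rw [mul_pow, hu, hv', one_mul],
        Or.inl fun z => by simp [hg, hh]; ring⟩
  inv_mem' := by
    rintro g ⟨u, hu, hg⟩
    have hu' := conj_mul_self_of_pow_eq_one three_ne_zero hu
    rcases hg with hg | hg
    · refine ⟨conj u, by rw [← map_pow, hu, map_one], Or.inl fun z => g.injective ?_⟩
      rw [hg (conj u * z)]
      change g (g.symm z) = _
      rw [g.apply_symm_apply]
      linear_combination -z * hu'
    · refine ⟨u, hu, Or.inr fun z => g.injective ?_⟩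
      rw [hg (u * conj z)]
      change g (g.symm z) = _
      rw [g.apply_symm_apply, map_mul, Complex.conj_conj]
      linear_combination -z * hu'

theorem dihedralThree_apply_mem {g : ℂ ≃ₗᵢ[ℝ] ℂ} (hg : g ∈ dihedralThree) {z : ℂ}
    (hz : z ∈ eisenstein) : g z ∈ eisenstein := by
  obtain ⟨u, hu, h | h⟩ := hg
  · rw [h]; exact mul_mem (cube_root_mem hu) hz
  · rw [h]; exact mul_mem (cube_root_mem hu) (conj_mem_eisenstein hz)

theorem finite_dihedralThree : (dihedralThree : Set (ℂ ≃ₗᵢ[ℝ] ℂ)).Finite := by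
  have hfin : {u : ℂ | u ^ 3 = 1}.Finite := by
    refine (Set.toFinite {1, kochApex - 1, -kochApex}).subset fun u hu => ?_
    simpa using cube_root_cases hu
  refine Set.Finite.of_finite_image (f := fun g : ℂ ≃ₗᵢ[ℝ] ℂ => (g 1, g Complex.I)) ?_ ?_
  · refine ((hfin.prod (hfin.image (· * Complex.I))).union
      (hfin.prod (hfin.image (· * -Complex.I)))).subset ?_
    rintro _ ⟨g, ⟨u, hu, h | h⟩, rfl⟩
    · exact Or.inl ⟨by simpa [h] using hu, u, hu, by simp [h]⟩
    · exact Or.inr ⟨by simpa [h] using hu, u, hu, by simp [h]⟩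
  · intro g _ h _ hgh
    obtain ⟨h1, h2⟩ := Prod.mk.inj hgh
    ext z
    have key : ∀ k : ℂ ≃ₗᵢ[ℝ] ℂ, k z = z.re • k 1 + z.im • k Complex.I := fun k => by
      rw [← map_smul, ← map_smul, ← map_add]; congr 1; simp
    rw [key g, key h, h1, h2]

/-- The lattice of vertices of the triangular grid of mesh `3⁻ⁿ`. -/
def grid (n : ℕ) : AddSubgroup ℂ where
  carrier := {z | 3 ^ n * z ∈ eisenstein}
  zero_mem' := by simp [zero_mem]
  add_mem' := fun ha hb => by
    simp only [Set.mem_ofPred_eq, mul_add] at *; exact add_mem ha hb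
  neg_mem' := fun ha => by
    simp only [Set.mem_ofPred_eq, mul_neg] at *; exact neg_mem ha

theorem mem_grid {n : ℕ} {z : ℂ} : z ∈ grid n ↔ 3 ^ n * z ∈ eisenstein := Iff.rfl

theorem dihedralThree_apply_mem_grid {n : ℕ} {g : ℂ ≃ₗᵢ[ℝ] ℂ} (hg : g ∈ dihedralThree) {z : ℂ}
    (hz : z ∈ grid n) : g z ∈ grid n := by
  rw [mem_grid] at *
  have h := dihedralThree_apply_mem hg hz
  have h2 : g (3 ^ n * z) = 3 ^ n * g z := by
    have := g.map_smul (3 ^ n : ℝ) z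
    simpa using this
  rwa [h2] at h

/-! ### Sides of `KS_n` and reflections in them. -/

/-- Replacing a side with rescaled vector `d` gives sides with rescaled vectors `d`, `d * conj ω`,
`d * ω`, `d`, where `ω = kochApex`. Sixth roots of unity are thus preserved. -/
theorem kochSides_spec {n : ℕ} {s : ℂ × ℂ} (hs : s ∈ kochSides n) :
    s.1 ∈ grid n ∧ ∃ d ∈ eisenstein, d ^ 6 = 1 ∧ 3 ^ n * (s.2 - s.1) = d := by
  have a2 := kochApex_mul_self
  have a3 : kochApex ^ 3 = -1 := by linear_combination (kochApex + 1) * a2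
  induction n generalizing s with
  | zero =>
    simp only [kochSides, Set.mem_insert_iff, Set.mem_singleton_iff] at hs
    simp only [mem_grid, pow_zero, one_mul]
    rcases hs with rfl | rfl | rfl
    · exact ⟨zero_mem _, 1, one_mem _, by simp, by simp⟩
    · exact ⟨one_mem _, kochApex - 1, sub_mem kochApex_mem (one_mem _),
        -- This is `ω ^ 12 = 1`: the coefficient comes from `x⁴ - 1 = (x³ - x² + x - 1)(x + 1)` at
        -- `x = ω³`.
        by rw [← a2]; linear_combination (kochApex ^ 9 - kochApex ^ 6 + kochApex ^ 3 - 1) * a3, rfl⟩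
    · exact ⟨kochApex_mem, -kochApex, neg_mem kochApex_mem,
        by linear_combination (kochApex ^ 3 - 1) * a3, by simp⟩
  | succ n ih =>
    simp only [kochSides, Set.mem_iUnion, Set.mem_insert_iff, Set.mem_singleton_iff] at hs
    obtain ⟨t, ht, hs⟩ := hs
    obtain ⟨h1, d, hd, hd6, hdt⟩ := ih ht
    have h1' : 3 ^ n * t.1 ∈ eisenstein := h1
    have h3 : (3 : ℂ) ∈ eisenstein := by exact_mod_cast natCast_mem eisenstein 3
    have e1 : (3 : ℂ) ^ (n + 1) * t.1 = 3 * (3 ^ n * t.1) := by ring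
    have m1 : 3 ^ (n + 1) * t.1 ∈ eisenstein := by rw [e1]; exact mul_mem h3 h1'
    have e2 : 3 ^ (n + 1) * kochFirst t = 3 ^ (n + 1) * t.1 + d := by
      rw [kochFirst, ← hdt]; ring
    have e3 : 3 ^ (n + 1) * kochTip t = 3 ^ (n + 1) * t.1 + d + d * (1 - kochApex) := by
      rw [kochTip, mul_add, e2, conj_kochApex, ← hdt]; ring
    have e4 : 3 ^ (n + 1) * kochSecond t = 3 ^ (n + 1) * t.1 + 2 * d := by
      rw [kochSecond, ← hdt]; ring
    have mc : d * (1 - kochApex) ∈ eisenstein := mul_mem hd (sub_mem (one_mem _) kochApex_mem)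
    rcases hs with rfl | rfl | rfl | rfl
    · exact ⟨m1, d, hd, hd6, by simp only [mul_sub, e2]; ring⟩
    · refine ⟨by rw [mem_grid, e2]; exact add_mem m1 hd, d * (1 - kochApex), mc, ?_, ?_⟩
      · rw [mul_pow, hd6]
        have : 1 - kochApex = -kochApex ^ 2 := by linear_combination a2
        rw [this]
        linear_combination (kochApex ^ 9 - kochApex ^ 6 + kochApex ^ 3 - 1) * a3
      · simp only [mul_sub, e2, e3]; ring
    · refine ⟨by rw [mem_grid, e3]; exact add_mem (add_mem m1 hd) mc, d * kochApex,
        mul_mem hd kochApex_mem, ?_, ?_⟩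
      · rw [mul_pow, hd6]; linear_combination (kochApex ^ 3 - 1) * a3
      · simp only [mul_sub, e3, e4]; ring
    · refine ⟨by rw [mem_grid, e4, two_mul]; exact add_mem m1 (add_mem hd hd), d, hd, hd6, ?_⟩
      simp only [mul_sub, e4]; linear_combination 3 * hdt

theorem finite_kochSides (n : ℕ) : (kochSides n).Finite := by
  induction n with
  | zero => exact Set.toFinite ({(0, 1), (1, kochApex), (kochApex, 0)} : Set (ℂ × ℂ))
  | succ n ih => exact ih.biUnion fun _ _ => Set.toFinite _

theorem reflection_apply_eq {w : ℂ} (hw : w ≠ 0) (z : ℂ) :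
    (Submodule.span ℝ {w}).reflection z = w / conj w * conj z := by
  have hw' : conj w ≠ 0 := by simpa using hw
  have hn : ((‖w‖ : ℝ) : ℂ) ^ 2 = w * conj w := by rw [Complex.mul_conj']
  have hi : ((inner ℝ w z : ℝ) : ℂ) = (conj w * z + w * conj z) / 2 := by
    rw [Complex.inner, Complex.re_eq_add_conj]; simp
    ring
  rw [Submodule.reflection_singleton_apply]
  simp only [Complex.real_smul, nsmul_eq_mul, Nat.cast_ofNat]
  simp only [RCLike.ofReal_real_eq_id, id]
  push_cast
  rw [hi, hn]
  field_simp
  ring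

theorem side_ne {n : ℕ} {s : ℂ × ℂ} (hs : s ∈ kochSides n) : s.2 - s.1 ≠ 0 := by
  obtain ⟨-, d, -, hd, h⟩ := kochSides_spec hs
  rintro h0
  rw [h0, mul_zero] at h
  simp [← h] at hd

/-- The reflection in the line `ℝw` is `z ↦ (w / conj w) * conj z`. For `w` proportional to a sixth
root of unity `d` the factor is `d ^ 2`, a cube root of unity whatever `n` is. -/
theorem reflection_side_mem {n : ℕ} {s : ℂ × ℂ} (hs : s ∈ kochSides n) :
    (Submodule.span ℝ {s.2 - s.1}).reflection ∈ dihedralThree := by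
  obtain ⟨-, d, -, hd, h⟩ := kochSides_spec hs
  have hw := side_ne hs
  refine ⟨d ^ 2, by rw [← pow_mul]; exact hd, Or.inr fun z => ?_⟩
  rw [reflection_apply_eq hw]
  have hc := conj_mul_self_of_pow_eq_one (by norm_num) hd
  have hw' : conj (s.2 - s.1) ≠ 0 := (map_ne_zero _).2 hw
  congr 1
  rw [div_eq_iff hw']
  have h3 : (3 : ℂ) ^ n ≠ 0 := pow_ne_zero _ three_ne_zero
  apply mul_left_cancel₀ h3
  have hcd : conj d = 3 ^ n * conj (s.2 - s.1) := by
    rw [← h, map_mul, map_pow, Complex.conj_ofNat]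
  linear_combination h + d ^ 2 * hcd - d * hc

/-- The affine map with linear part `g` fixing `y` has translation part `y - g y`. For a single
reflection, `y` may be replaced by the endpoint `s.1` of the side, which is a grid point. -/
theorem reflectionGroup_spec {n : ℕ} {y : ℂ} {g : ℂ ≃ₗᵢ[ℝ] ℂ} (hg : g ∈ reflectionGroup n y) :
    g ∈ dihedralThree ∧ y - g y ∈ grid n := by
  induction hg using Subgroup.closure_induction with
  | mem r hr =>
    obtain ⟨s, hs, hy, rfl⟩ := hr
    have hr := reflection_side_mem hs
    refine ⟨hr, ?_⟩
    have hfix : (Submodule.span ℝ {s.2 - s.1}).reflection (y - s.1) = y - s.1 := by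
      apply Submodule.reflection_mem_subspace_eq_self
      rw [segment_eq_image'] at hy
      obtain ⟨t, -, rfl⟩ := hy
      rw [add_sub_cancel_left]
      exact Submodule.smul_mem _ _ (Submodule.mem_span_singleton_self _)
    rw [map_sub] at hfix
    have h1 := (kochSides_spec hs).1
    have : y - (Submodule.span ℝ {s.2 - s.1}).reflection y
        = s.1 - (Submodule.span ℝ {s.2 - s.1}).reflection s.1 := by
      linear_combination -hfix
    rw [this]
    exact sub_mem h1 (dihedralThree_apply_mem_grid hr h1)
  | one => exact ⟨one_mem _, by simp [zero_mem]⟩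
  | mul g h _ _ hg hh =>
    refine ⟨mul_mem hg.1 hh.1, ?_⟩
    have : y - (g * h) y = (y - g y) + g (y - h y) := by
      rw [map_sub]; simp
    rw [this]
    exact add_mem hg.2 (dihedralThree_apply_mem_grid hg.1 hh.2)
  | inv g _ hg =>
    refine ⟨inv_mem hg.1, ?_⟩
    have : y - g⁻¹ y = -(g⁻¹ (y - g y)) := by
      have : g⁻¹ (g y) = y := g.symm_apply_apply y
      rw [map_sub, this]; ring
    rw [this]
    exact neg_mem (dihedralThree_apply_mem_grid (inv_mem hg.1) hg.2)

/-! ### Unfolding of trajectories. -/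

/-- After travelling a distance `T` along its unfolded trajectory, `p` arrives at a state that a
symmetry of the grid of mesh `3⁻ⁿ` carries to `q`. -/
def Unfolds (n : ℕ) (T : ℝ) (p q : ℂ × Circle) : Prop :=
  ∃ g ∈ dihedralThree, ∃ b ∈ grid n, (q.2 : ℂ) = g p.2 ∧ q.1 = g (p.1 + T * p.2) + b

theorem Unfolds.refl (n : ℕ) (p : ℂ × Circle) : Unfolds n 0 p p :=
  ⟨1, one_mem _, 0, zero_mem _, by simp, by simp⟩

theorem map_ofReal_mul (g : ℂ ≃ₗᵢ[ℝ] ℂ) (T : ℝ) (z : ℂ) : g (T * z) = T * g z := by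
  simpa using g.map_smul T z

theorem Unfolds.trans {n : ℕ} {S T : ℝ} {p q r : ℂ × Circle} (h : Unfolds n S p q)
    (h' : Unfolds n T q r) : Unfolds n (S + T) p r := by
  obtain ⟨g, hg, b, hb, h1, h2⟩ := h
  obtain ⟨g', hg', b', hb', h1', h2'⟩ := h'
  refine ⟨g' * g, mul_mem hg' hg, g' b + b',
    add_mem (dihedralThree_apply_mem_grid hg' hb) hb', by simp [h1', h1], ?_⟩
  rw [h2', h2, h1]
  have hm : ∀ z, (g' * g) z = g' (g z) := fun _ => rfl
  simp only [map_add, map_ofReal_mul, hm]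
  push_cast
  ring

theorem Unfolds.symm {n : ℕ} {T : ℝ} {p q : ℂ × Circle} (h : Unfolds n T p q) :
    Unfolds n (-T) q p := by
  obtain ⟨g, hg, b, hb, h1, h2⟩ := h
  have hgg : ∀ z, g⁻¹ (g z) = z := g.symm_apply_apply
  refine ⟨g⁻¹, inv_mem hg, -(g⁻¹ b),
    neg_mem (dihedralThree_apply_mem_grid (inv_mem hg) hb), by rw [h1, hgg], ?_⟩
  rw [h2, h1]
  simp only [map_add, map_ofReal_mul, hgg]
  push_cast
  ring

theorem BilliardMap.unfolds {n : ℕ} {p q : ℂ × Circle} (h : BilliardMap n p q) :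
    ∃ T > 0, Unfolds n T p q := by
  obtain ⟨-, -, ⟨t, ht, hy, -⟩, -, g, hg, hgq⟩ := h
  obtain ⟨hg1, hg2⟩ := reflectionGroup_spec hg
  exact ⟨t, ht, g, hg1, q.1 - g q.1, hg2, hgq.symm, by rw [← hy]; ring⟩

theorem unfolds_of_reflTransGen {n : ℕ} {p q : ℂ × Circle}
    (h : Relation.ReflTransGen (BilliardMap n) p q) : ∃ T, Unfolds n T p q := by
  induction h with
  | refl => exact ⟨0, Unfolds.refl n p⟩
  | tail _ h ih =>
    obtain ⟨S, hS⟩ := ih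
    obtain ⟨T, -, hT⟩ := h.unfolds
    exact ⟨S + T, hS.trans hT⟩

/-! ### Rational directions. -/

/-- The direction `θ` is parallel to a nonzero vector of the triangular lattice. -/
def IsRationalDirection (θ : Circle) : Prop := ∃ T > (0 : ℝ), (T : ℂ) * θ ∈ eisenstein

/-- The closing symmetry has a linear part fixing the direction. A rotation must then be the
identity, and the flight vector is `-b`. A reflection gives a glide reflection, whose square is a
translation by a lattice vector. -/
theorem IsRationalDirection.of_unfolds_self {T : ℝ} (hT : 0 < T) {p : ℂ × Circle}
    (h : Unfolds 0 T p p) : IsRationalDirection p.2 := by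
  obtain ⟨g, hg, b, hb, h1, h2⟩ := h
  rw [map_add, map_ofReal_mul, ← h1] at h2
  rw [mem_grid, pow_zero, one_mul] at hb
  have hp : (p.2 : ℂ) ≠ 0 := p.2.coe_ne_zero
  have hgb := dihedralThree_apply_mem hg hb
  obtain ⟨u, hu, h | h⟩ := hg
  · rw [h] at h1 h2
    have hu1 : u = 1 := by
      have : (u - 1) * (p.2 : ℂ) = 0 := by linear_combination -h1
      rcases mul_eq_zero.1 this with h | h
      · exact sub_eq_zero.1 h
      · exact absurd h hp
    refine ⟨T, hT, ?_⟩
    have : (T : ℂ) * p.2 = -b := by rw [hu1] at h2; linear_combination -h2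
    rw [this]
    exact neg_mem hb
  · have hu' := conj_mul_self_of_pow_eq_one three_ne_zero hu
    have h3 : g p.1 = p.1 + T * p.2 + g b := by
      have := congrArg g h2
      rw [map_add, map_add, map_ofReal_mul, ← h1, h (g p.1), h p.1, map_mul,
        Complex.conj_conj] at this
      rw [h p.1]
      linear_combination this + p.1 * hu'
    refine ⟨2 * T, by positivity, ?_⟩
    have : ((2 * T : ℝ) : ℂ) * p.2 = -(b + g b) := by
      push_cast; linear_combination -h2 - h3
    rw [this]
    exact neg_mem (add_mem hb hgb)

theorem IsRationalDirection.of_unfolds {n : ℕ} {T : ℝ} {p q : ℂ × Circle} (h : Unfolds n T p q)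
    (hp : IsRationalDirection p.2) : IsRationalDirection q.2 := by
  obtain ⟨g, hg, -, -, h1, -⟩ := h
  obtain ⟨S, hS, hm⟩ := hp
  exact ⟨S, hS, by rw [h1, ← map_ofReal_mul]; exact dihedralThree_apply_mem hg hm⟩

/-! ### The billiard in the triangle `KS_0`. -/

/-- Twice the signed area spanned by the `j`-th side of the initial triangle and `z`. -/
noncomputable def sideForm (j : Fin 3) (z : ℂ) : ℝ :=
  ![z.im, -(z.im / 2) - Real.sqrt 3 / 2 * z.re, -(z.im / 2) + Real.sqrt 3 / 2 * z.re] j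

/-- The signed distance of `z` from the `j`-th side of the initial triangle. -/
noncomputable def sideHeight (j : Fin 3) (z : ℂ) : ℝ := sideForm j z + ![0, Real.sqrt 3 / 2, 0] j

/-- The sides of the initial triangle, in counterclockwise order. -/
noncomputable def triangleSide : Fin 3 → ℂ × ℂ := ![(0, 1), (1, kochApex), (kochApex, 0)]

theorem mem_kochSides_zero {s : ℂ × ℂ} : s ∈ kochSides 0 ↔ ∃ j, s = triangleSide j := by
  simp [kochSides, triangleSide, Fin.exists_fin_succ]

theorem sideForm_sum (z : ℂ) : sideForm 0 z + sideForm 1 z + sideForm 2 z = 0 := by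
  simp [sideForm]; ring

theorem sideHeight_sum (z : ℂ) :
    sideHeight 0 z + sideHeight 1 z + sideHeight 2 z = Real.sqrt 3 / 2 := by
  simp [sideHeight, sideForm]; ring

theorem sideForm_ext {z w : ℂ} (h : ∀ j, sideForm j z = sideForm j w) : z = w := by
  have h0 := h 0
  have h1 := h 1
  simp only [sideForm, Matrix.cons_val_zero, Matrix.cons_val_one] at h0 h1
  have h3 : (0 : ℝ) < Real.sqrt 3 := by positivity
  refine Complex.ext (mul_left_cancel₀ h3.ne' ?_) h0
  linarith

theorem sideHeight_add_mul (j : Fin 3) (x z : ℂ) (t : ℝ) :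
    sideHeight j (x + t * z) = sideHeight j x + t * sideForm j z := by
  fin_cases j <;> simp [sideHeight, sideForm] <;> ring

theorem sideHeight_convexCombo (j : Fin 3) (x y : ℂ) {a b : ℝ} (hab : a + b = 1) :
    sideHeight j (a • x + b • y) = a * sideHeight j x + b * sideHeight j y := by
  obtain rfl : b = 1 - a := by linarith
  fin_cases j <;> simp [sideHeight, sideForm] <;> ring

theorem continuous_sideHeight (j : Fin 3) : Continuous (sideHeight j) := by
  unfold sideHeight sideForm
  fin_cases j <;> simp <;> fun_prop

theorem kochTable_zero : kochTable 0 = {z | ∀ j, 0 ≤ sideHeight j z} := by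
  have h3 : (0 : ℝ) < Real.sqrt 3 := by positivity
  have hs : Real.sqrt 3 * Real.sqrt 3 = 3 := Real.mul_self_sqrt (by norm_num)
  apply Set.Subset.antisymm
  · refine convexHull_min ?_ ?_
    · rintro z (rfl | rfl | rfl) j <;>
      fin_cases j <;> simp [sideHeight, sideForm, kochApex]
      all_goals nlinarith
    · intro x hx y hy a b ha hb hab j
      rw [sideHeight_convexCombo j x y hab]
      exact add_nonneg (mul_nonneg ha (hx j)) (mul_nonneg hb (hy j))
  · intro z hz
    -- The barycentric coordinate at a vertex is the height above the opposite side divided by the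
    -- total height `√3 / 2`.
    have key : z = (2 / Real.sqrt 3 * sideHeight 1 z) • (0 : ℂ) +
        (2 / Real.sqrt 3 * sideHeight 2 z) • (1 : ℂ) +
        (2 / Real.sqrt 3 * sideHeight 0 z) • kochApex := by
      apply Complex.ext <;> simp [sideHeight, sideForm, kochApex] <;> field_simp <;> ring
    have hw : 2 / Real.sqrt 3 * sideHeight 1 z + 2 / Real.sqrt 3 * sideHeight 2 z
        + 2 / Real.sqrt 3 * sideHeight 0 z = 1 := by
      rw [← mul_add, ← mul_add, add_comm, ← add_assoc, sideHeight_sum]; field_simp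
    have hp : ∀ j, 0 ≤ 2 / Real.sqrt 3 * sideHeight j z := fun j =>
      mul_nonneg (by positivity) (hz j)
    rw [key]
    have hc := convex_convexHull ℝ ({0, 1, kochApex} : Set ℂ)
    have hsub := subset_convexHull ℝ ({0, 1, kochApex} : Set ℂ)
    have := hc.sum_mem (t := Finset.univ) (w := ![2 / Real.sqrt 3 * sideHeight 1 z,
      2 / Real.sqrt 3 * sideHeight 2 z, 2 / Real.sqrt 3 * sideHeight 0 z])
      (z := ![0, 1, kochApex])
      (by intro i _; fin_cases i <;> simp [hp]) (by simpa [Fin.sum_univ_three] using hw)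
      (by intro i _; fin_cases i <;> exact hsub (by simp))
    rw [Fin.sum_univ_three] at this
    exact this

theorem mem_triangleSide {j : Fin 3} {z : ℂ} :
    z ∈ segment ℝ (triangleSide j).1 (triangleSide j).2 ↔
      (∀ i, 0 ≤ sideHeight i z) ∧ sideHeight j z = 0 := by
  have h3 : (0 : ℝ) < Real.sqrt 3 := by positivity
  have hs : Real.sqrt 3 * Real.sqrt 3 = 3 := Real.mul_self_sqrt (by norm_num)
  constructor
  · rintro ⟨a, b, ha, hb, hab, rfl⟩
    have : ∀ i, 0 ≤ sideHeight i (triangleSide j).1 ∧ 0 ≤ sideHeight i (triangleSide j).2 ∧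
        sideHeight j (triangleSide j).1 = 0 ∧ sideHeight j (triangleSide j).2 = 0 := by
      intro i
      refine ⟨?_, ?_, ?_, ?_⟩ <;> fin_cases j <;> fin_cases i <;>
        simp [sideHeight, sideForm, kochApex, triangleSide] <;> nlinarith
    refine ⟨fun i => ?_, ?_⟩
    · rw [sideHeight_convexCombo i _ _ hab]
      exact add_nonneg (mul_nonneg ha (this i).1) (mul_nonneg hb (this i).2.1)
    · rw [sideHeight_convexCombo j _ _ hab, (this 0).2.2.1, (this 0).2.2.2]; simp
  · rintro ⟨h, h0⟩
    have hsum := sideHeight_sum z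
    have hp : ∀ j, 0 ≤ 2 / Real.sqrt 3 * sideHeight j z := fun j =>
      mul_nonneg (by positivity) (h j)
    have hw : 2 / Real.sqrt 3 * (sideHeight 0 z + sideHeight 1 z + sideHeight 2 z) = 1 := by
      rw [hsum]; field_simp
    -- Side `j` starts at the vertex opposite side `j + 1` and ends at the one opposite side `j +
    -- 2`, indices modulo 3.
    refine ⟨2 / Real.sqrt 3 * sideHeight (j + 1) z, 2 / Real.sqrt 3 * sideHeight (j + 2) z,
      hp _, hp _, ?_, ?_⟩
    · rw [← hw]
      fin_cases j <;> simp at h0 ⊢ <;> rw [h0] <;> ring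
    · have hr : 2 / Real.sqrt 3 * Real.sqrt 3 = 2 := by field_simp
      fin_cases j <;> simp [sideHeight, sideForm] at h0 <;>
        apply Complex.ext <;> simp [sideHeight, sideForm, kochApex, triangleSide]
      · linear_combination (z.re / 2) * hr - (1 / Real.sqrt 3) * h0
      · linear_combination -h0
      · linear_combination (z.re / 2) * hr
      · linear_combination (z.im / 2) * hr
      · linear_combination (z.re / 2) * hr - (2 / Real.sqrt 3) * h0
      · linear_combination (z.im / 2) * hr

theorem mem_kochCurve_zero {z : ℂ} :
    z ∈ kochCurve 0 ↔ (∀ i, 0 ≤ sideHeight i z) ∧ ∃ j, sideHeight j z = 0 := by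
  simp only [kochCurve, Set.mem_iUnion, mem_kochSides_zero]
  constructor
  · rintro ⟨_, ⟨j, rfl⟩, h⟩
    exact ⟨(mem_triangleSide.1 h).1, j, (mem_triangleSide.1 h).2⟩
  · rintro ⟨h, j, hj⟩
    exact ⟨_, ⟨j, rfl⟩, mem_triangleSide.2 ⟨h, hj⟩⟩

theorem interior_kochTable_zero : interior (kochTable 0) = {z | ∀ j, 0 < sideHeight j z} := by
  apply Set.Subset.antisymm
  · intro z hz j
    have hz' : ∀ i, 0 ≤ sideHeight i z := by
      have := interior_subset hz
      rwa [kochTable_zero] at this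
    refine lt_of_le_of_ne (hz' j) fun h0 => ?_
    obtain ⟨w, hw⟩ : ∃ w, sideForm j w < 0 := by
      fin_cases j
      exacts [⟨-Complex.I, by simp [sideForm]⟩, ⟨1, by simp [sideForm]⟩,
        ⟨-1, by simp [sideForm]⟩]
    have hc : Continuous fun t : ℝ => z + t * w := by fun_prop
    have ho : (fun t : ℝ => z + t * w) ⁻¹' interior (kochTable 0) ∈ nhds (0 : ℝ) :=
      hc.continuousAt.preimage_mem_nhds (by simpa using isOpen_interior.mem_nhds hz)
    obtain ⟨t, ht, ht0⟩ := (Filter.Eventually.and (nhdsWithin_le_nhds ho)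
      (self_mem_nhdsWithin (s := Set.Ioi (0 : ℝ)))).exists
    have := interior_subset ht
    rw [kochTable_zero] at this
    have h1 := this j
    rw [sideHeight_add_mul, ← h0] at h1
    have : t * sideForm j w < 0 := mul_neg_of_pos_of_neg ht0 hw
    linarith
  · refine interior_maximal ?_ ?_
    · rw [kochTable_zero]; exact fun z hz j => (hz j).le
    · have : {z : ℂ | ∀ j, 0 < sideHeight j z} = ⋂ j, {z | 0 < sideHeight j z} := by ext; simp
      rw [this]
      exact isOpen_iInter_of_finite fun j => isOpen_lt continuous_const (continuous_sideHeight j)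

theorem isInward_zero_iff {x : ℂ} (hx : ∀ j, 0 ≤ sideHeight j x) {θ : Circle} :
    IsInward 0 x θ ↔ ∀ j, sideHeight j x = 0 → 0 < sideForm j θ := by
  unfold IsInward
  rw [interior_kochTable_zero]
  constructor
  · rintro ⟨ε, hε, h⟩ j hj
    have := h (ε / 2) ⟨by positivity, by linarith⟩ j
    rw [sideHeight_add_mul, hj, zero_add] at this
    exact pos_of_mul_pos_right this (by positivity)
  · intro h
    have hev : ∀ᶠ t : ℝ in nhdsWithin 0 (Set.Ioi 0), ∀ j, 0 < sideHeight j (x + t * θ) := by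
      rw [Filter.eventually_all]
      intro j
      rcases (hx j).eq_or_lt with h0 | h0
      · filter_upwards [self_mem_nhdsWithin] with t ht
        rw [sideHeight_add_mul, ← h0, zero_add]
        exact mul_pos ht (h j h0.symm)
      · apply Filter.Eventually.filter_mono nhdsWithin_le_nhds
        have hc : Continuous fun t : ℝ => sideHeight j (x + t * θ) :=
          (continuous_sideHeight j).comp (by fun_prop)
        exact hc.continuousAt.eventually (lt_mem_nhds (by simpa using h0))
    obtain ⟨ε, hε, hsub⟩ := mem_nhdsGT_iff_exists_Ioo_subset.1 hev
    exact ⟨ε, hε, fun t ht => hsub ht⟩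

/-- Heights are affine along the flight. The forms sum to zero, so some side is approached, and the
least ratio of height to approach speed is the hitting time. Every side met there is approached
strictly, which the reflection step needs. -/
theorem exists_firstCollision_zero {p : ℂ × Circle} (hp : IsPhasePoint 0 p) :
    ∃ y, IsFirstCollision 0 p y ∧ ∀ j, sideHeight j y = 0 → sideForm j p.2 < 0 := by
  obtain ⟨hx, -⟩ := mem_kochCurve_zero.1 hp.1
  have hin := (isInward_zero_iff hx).1 hp.2
  have hne : (Finset.univ.filter fun j : Fin 3 => sideForm j p.2 < 0).Nonempty := by
    by_contra hcon
    rw [Finset.not_nonempty_iff_eq_empty, Finset.filter_eq_empty_iff] at hcon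
    have hn : ∀ j, 0 ≤ sideForm j p.2 := fun j => not_lt.1 (hcon (Finset.mem_univ j))
    have hs := sideForm_sum p.2
    have := hn 0
    have := hn 1
    have := hn 2
    apply p.2.coe_ne_zero
    apply sideForm_ext
    intro j
    have : sideForm j 0 = 0 := by fin_cases j <;> simp [sideForm]
    rw [this]
    fin_cases j <;> simp <;> linarith
  obtain ⟨j, hj, hmin⟩ := Finset.exists_min_image _
    (fun j => sideHeight j p.1 / -sideForm j p.2) hne
  simp only [Finset.mem_filter, Finset.mem_univ, true_and] at hj hmin
  set T := sideHeight j p.1 / -sideForm j p.2 with hTdef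
  have hT : 0 < T := by
    refine div_pos (lt_of_le_of_ne (hx j) fun h => ?_) (by linarith)
    exact absurd (hin j h.symm) (by linarith)
  have hposi : ∀ i, 0 ≤ sideForm i p.2 → ∀ t : ℝ, 0 < t → 0 < sideHeight i (p.1 + t * p.2) := by
    intro i hi t ht
    rw [sideHeight_add_mul]
    rcases (hx i).eq_or_lt with h0 | h0
    · rw [← h0, zero_add]; exact mul_pos ht (hin i h0.symm)
    · have := mul_nonneg ht.le hi; linarith
  have hle : ∀ i, sideForm i p.2 < 0 → T * -sideForm i p.2 ≤ sideHeight i p.1 := fun i hi =>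
    (le_div_iff₀ (by linarith)).1 (hmin i hi)
  refine ⟨p.1 + T * p.2, ⟨T, hT, rfl, mem_kochCurve_zero.2 ⟨fun i => ?_, j, ?_⟩, ?_⟩, ?_⟩
  · rcases lt_or_ge (sideForm i p.2) 0 with hi | hi
    · rw [sideHeight_add_mul]; linarith [hle i hi]
    · exact (hposi i hi T hT).le
  · rw [sideHeight_add_mul, hTdef, div_neg, neg_mul, div_mul_cancel₀ _ hj.ne]; ring
  · rintro t ⟨ht0, htT⟩ hmem
    obtain ⟨-, i, hi⟩ := mem_kochCurve_zero.1 hmem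
    rcases lt_or_ge (sideForm i p.2) 0 with hneg | hn
    · rw [sideHeight_add_mul] at hi
      nlinarith [hle i hneg]
    · exact absurd hi (hposi i hn t ht0).ne'
  · intro i hi
    by_contra hn
    exact absurd hi (hposi i (not_lt.1 hn) T hT).ne'

/-- The linear reflection in the `j`-th side of the initial triangle. -/
noncomputable def sideReflection (j : Fin 3) : ℂ ≃ₗᵢ[ℝ] ℂ :=
  (Submodule.span ℝ {(triangleSide j).2 - (triangleSide j).1}).reflection

/-- Reflections permute the three side forms up to a sign, rotations without sign. Index arithmetic
modulo 3 then replaces geometry. -/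
theorem sideForm_mul_conj (i j : Fin 3) (z : ℂ) :
    sideForm i (![1, -kochApex, kochApex - 1] j * conj z) = -sideForm (-(i + j)) z := by
  have hs : Real.sqrt 3 * Real.sqrt 3 = 3 := Real.mul_self_sqrt (by norm_num)
  fin_cases i <;> fin_cases j <;>
    simp [sideForm, kochApex] <;>
    first
    | ring1
    | linear_combination (z.im / 4) * hs
    | linear_combination (-z.im / 4) * hs

theorem sideForm_mul (i j : Fin 3) (z : ℂ) :
    sideForm i (![1, kochApex - 1, -kochApex] j * z) = sideForm (i - j) z := by
  have hs : Real.sqrt 3 * Real.sqrt 3 = 3 := Real.mul_self_sqrt (by norm_num)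
  fin_cases i <;> fin_cases j <;>
    simp [sideForm, kochApex] <;>
    first
    | ring1
    | linear_combination (z.im / 4) * hs
    | linear_combination (-z.im / 4) * hs

theorem sideForm_sideReflection (i j : Fin 3) (z : ℂ) :
    sideForm i (sideReflection j z) = -sideForm (-(i + j)) z := by
  rw [← sideForm_mul_conj, sideReflection, reflection_apply_eq
    (side_ne (mem_kochSides_zero.2 ⟨j, rfl⟩))]
  congr 2
  have hs := side_ne (mem_kochSides_zero.2 ⟨j, rfl⟩)
  rw [div_eq_iff ((map_ne_zero _).2 hs)]
  have h := kochApex_mul_self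
  fin_cases j <;> simp [triangleSide, conj_kochApex]
  · linear_combination -h
  · linear_combination -h

theorem sideReflection_mem {y : ℂ} (hy : ∀ i, 0 ≤ sideHeight i y) {j : Fin 3}
    (hj : sideHeight j y = 0) : sideReflection j ∈ reflectionGroup 0 y :=
  Subgroup.subset_closure ⟨triangleSide j, mem_kochSides_zero.2 ⟨j, rfl⟩,
    mem_triangleSide.2 ⟨hy, hj⟩, rfl⟩

/-- The heights have positive sum, so at most two vanish. Away from the vertices `j = k`. -/
theorem exists_pair_of_mem_kochCurve_zero {y : ℂ} (hy : y ∈ kochCurve 0) :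
    ∃ j k, sideHeight j y = 0 ∧ sideHeight k y = 0 ∧ ∀ i, sideHeight i y = 0 → i = j ∨ i = k := by
  obtain ⟨-, j, hj⟩ := mem_kochCurve_zero.1 hy
  by_cases h : ∃ k, k ≠ j ∧ sideHeight k y = 0
  · obtain ⟨k, hkj, hk⟩ := h
    refine ⟨j, k, hj, hk, fun i hi => ?_⟩
    by_contra! hcon
    have hall : ∀ l, sideHeight l y = 0 := by
      intro l
      have : l = j ∨ l = k ∨ l = i := by omega
      rcases this with rfl | rfl | rfl <;> assumption
    have hs := sideHeight_sum y
    rw [hall, hall, hall] at hs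
    have h3 : (0 : ℝ) < Real.sqrt 3 := by positivity
    linarith
  · exact ⟨j, j, hj, hj, fun i hi => Or.inl (by_contra fun hne => h ⟨i, hne, hi⟩)⟩

theorem exists_inward_dirEquiv {y : ℂ} (hy : y ∈ kochCurve 0) {θ : Circle}
    (hθ : ∀ j, sideHeight j y = 0 → sideForm j θ < 0) :
    ∃ φ : Circle, DirEquiv 0 y θ φ ∧ IsInward 0 y φ := by
  have hpos := (mem_kochCurve_zero.1 hy).1
  obtain ⟨j, k, hj, hk, hjk⟩ := exists_pair_of_mem_kochCurve_zero hy
  -- At a vertex this is the longest element of the dihedral group, sending the outward chamber to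
  -- the inward one; for `j = k` it is the single reflection.
  set g := sideReflection j * (sideReflection k * sideReflection j) with hg
  have hmem : g ∈ reflectionGroup 0 y := mul_mem (sideReflection_mem hpos hj)
    (mul_mem (sideReflection_mem hpos hk) (sideReflection_mem hpos hj))
  have hform : ∀ i, sideForm i (g θ) = -sideForm (j + k - i) θ := by
    intro i
    change sideForm i (sideReflection j (sideReflection k (sideReflection j θ))) = _
    simp only [sideForm_sideReflection, neg_neg, neg_inj]
    rw [show ∀ a b c : Fin 3, -(-(-(a + b) + c) + b) = b + c - a by decide]
  refine ⟨⟨g θ, mem_sphere_zero_iff_norm.2 (by rw [g.norm_map, Circle.norm_coe])⟩, ⟨g, hmem, rfl⟩,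
    (isInward_zero_iff hpos).2 fun i hi => ?_⟩
  change 0 < sideForm i (g θ)
  rw [hform, Left.neg_pos_iff]
  rcases hjk i hi with rfl | rfl
  · rw [add_sub_cancel_left]; exact hθ k hk
  · rw [add_sub_cancel_right]; exact hθ j hj

theorem sideForm_of_mem_dihedralThree {g : ℂ ≃ₗᵢ[ℝ] ℂ} (hg : g ∈ dihedralThree) :
    ∃ j, (∀ i z, sideForm i (g z) = sideForm (i - j) z) ∨
      ∀ i z, sideForm i (g z) = -sideForm (-(i + j)) z := by
  obtain ⟨u, hu, h | h⟩ := hg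
  · obtain ⟨j, rfl⟩ : ∃ j, u = ![1, kochApex - 1, -kochApex] j := by
      rcases cube_root_cases hu with rfl | rfl | rfl
      exacts [⟨0, rfl⟩, ⟨1, rfl⟩, ⟨2, rfl⟩]
    exact ⟨j, Or.inl fun i z => by rw [h, sideForm_mul]⟩
  · obtain ⟨j, rfl⟩ : ∃ j, u = ![1, -kochApex, kochApex - 1] j := by
      rcases cube_root_cases hu with rfl | rfl | rfl
      exacts [⟨0, rfl⟩, ⟨2, rfl⟩, ⟨1, rfl⟩]
    exact ⟨j, Or.inr fun i z => by rw [h, sideForm_mul_conj]⟩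

/-- The inward directions at a `π/3` corner form an open chamber of the dihedral group of order six,
so no orbit of the group meets them twice. -/
theorem reflectionDefined_zero {y : ℂ} (hy : y ∈ kochCurve 0) : ReflectionDefined 0 y := by
  rintro φ ψ hφ hψ ⟨g, hg, hgφ⟩
  have hpos := (mem_kochCurve_zero.1 hy).1
  rw [isInward_zero_iff hpos] at hφ hψ
  obtain ⟨j, k, hj, hk, hjk⟩ := exists_pair_of_mem_kochCurve_zero hy
  have hφj := hφ j hj
  have hφk := hφ k hk
  have hψj := hψ j hj
  have hψk := hψ k hk
  rw [← hgφ] at hψj hψk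
  by_cases hne : j = k
  · subst hne
    have hgj : g = 1 ∨ g = sideReflection j := by
      have hsq : sideReflection j * sideReflection j = 1 := Submodule.reflection_mul_reflection _
      clear hgφ hψj hψk
      induction hg using Subgroup.closure_induction with
      | mem r hr =>
        obtain ⟨s, hs, hys, rfl⟩ := hr
        obtain ⟨i, rfl⟩ := mem_kochSides_zero.1 hs
        rcases hjk i (mem_triangleSide.1 hys).2 with rfl | rfl <;> exact Or.inr rfl
      | one => exact Or.inl rfl
      | mul a b _ _ ha hb =>
        rcases ha with rfl | rfl <;> rcases hb with rfl | rfl <;> simp [hsq]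
      | inv a _ ha =>
        rcases ha with rfl | rfl
        · simp
        · exact Or.inr (inv_eq_of_mul_eq_one_left hsq)
    rcases hgj with rfl | rfl
    · exact Circle.ext hgφ
    · rw [sideForm_sideReflection] at hψj
      have hfin : ∀ a : Fin 3, -(a + a) = a := by decide
      rw [hfin] at hψj
      linarith
  -- Inward directions have forms `j`, `k` positive, hence the third negative. A nontrivial rotation
  -- moves the negative form to `j` or `k`; a reflection makes one of these two negative.
  · have hsum := sideForm_sum (φ : ℂ)
    have hm1 : (-1 : Fin 3) = 2 := rfl
    have hm2 : (-2 : Fin 3) = 1 := rfl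
    obtain ⟨m, hm | hm⟩ := sideForm_of_mem_dihedralThree (reflectionGroup_spec hg).1
    · have hm0 : m = 0 := by
        rw [hm] at hψj hψk
        by_contra hm0
        fin_cases j <;> fin_cases k <;> fin_cases m <;> simp [hm1, hm2] at * <;> linarith
      refine Circle.ext (sideForm_ext fun i => ?_)
      rw [← hgφ, hm, hm0, sub_zero]
    · exfalso
      rw [hm] at hψj hψk
      clear hm hgφ hjk
      fin_cases j <;> fin_cases k <;> fin_cases m <;> simp [hm1, hm2] at * <;> linarith

theorem exists_billiardMap_zero {p : ℂ × Circle} (hp : IsPhasePoint 0 p) :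
    ∃ q, BilliardMap 0 p q := by
  obtain ⟨y, hy, hneg⟩ := exists_firstCollision_zero hp
  have hyc : y ∈ kochCurve 0 := by obtain ⟨_, _, _, h, _⟩ := hy; exact h
  obtain ⟨φ, hφ, hin⟩ := exists_inward_dirEquiv hyc hneg
  exact ⟨(y, φ), hp, ⟨hyc, hin⟩, hy, reflectionDefined_zero hyc, hφ⟩

theorem isRationalDirection_of_isClosedOrbit_zero {p : ℂ × Circle} (hp : IsPhasePoint 0 p)
    (h : IsClosedOrbit 0 p) : IsRationalDirection p.2 := by
  choose f hf using fun x : {p // IsPhasePoint 0 p} => exists_billiardMap_zero x.2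
  let F : {p // IsPhasePoint 0 p} → {p // IsPhasePoint 0 p} := fun x => ⟨f x, (hf x).2.1⟩
  let x : ℕ → {p // IsPhasePoint 0 p} := fun k => F^[k] ⟨p, hp⟩
  have hstep : ∀ k, BilliardMap 0 (x k) (x (k + 1)) := by
    intro k
    have : x (k + 1) = F (x k) := Function.iterate_succ_apply' F k _
    rw [this]
    exact hf (x k)
  have hreach : ∀ k, Relation.ReflTransGen (BilliardMap 0) p (x k) := by
    intro k
    induction k with
    | zero => exact Relation.ReflTransGen.refl
    | succ k ih => exact ih.tail (hstep k)
  have hunf : ∀ i k, ∃ T > 0, Unfolds 0 T (x i) (x (i + k + 1)) := by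
    intro i k
    induction k with
    | zero => exact (hstep i).unfolds
    | succ k ih =>
      obtain ⟨S, hS, h1⟩ := ih
      obtain ⟨T, hT, h2⟩ := (hstep (i + k + 1)).unfolds
      exact ⟨S + T, add_pos hS hT, h1.trans h2⟩
  obtain ⟨i, j, hij, hxx⟩ : ∃ i j, i < j ∧ (x i : ℂ × Circle) = x j := by
    have : (Set.range fun k => (x k : ℂ × Circle)).Finite := Set.Finite.subset h
      (by rintro _ ⟨k, rfl⟩; exact Or.inl (hreach k))
    obtain ⟨i, j, hne, he⟩ : ∃ i j, i ≠ j ∧ (x i : ℂ × Circle) = x j := by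
      by_contra! hcon
      exact Set.infinite_range_of_injective
        (fun i j he => by_contra fun hne => hcon i j hne he) this
    rcases hne.lt_or_gt with hlt | hlt
    exacts [⟨i, j, hlt, he⟩, ⟨j, i, hlt, he.symm⟩]
  obtain ⟨k, rfl⟩ := Nat.exists_eq_add_of_lt hij
  obtain ⟨T, hT, hself⟩ := hunf i k
  rw [← hxx] at hself
  obtain ⟨S, hS⟩ := unfolds_of_reflTransGen (hreach i)
  exact (IsRationalDirection.of_unfolds_self hT hself).of_unfolds hS.symm

/-! ### Orbits of `KS_n` in a rational direction. -/

theorem im_conj_mul_add_real_mul (w z : ℂ) (t : ℝ) :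
    (conj w * (z + t * w)).im = (conj w * z).im := by
  simp; ring

/-- A line in the direction `w` meets a segment that is not parallel to it at most once. -/
theorem eq_of_mem_segment_of_im_eq {a b w x y : ℂ} (hw : (conj w * (b - a)).im ≠ 0)
    (hx : x ∈ segment ℝ a b) (hy : y ∈ segment ℝ a b)
    (h : (conj w * x).im = (conj w * y).im) : x = y := by
  rw [segment_eq_image'] at hx hy
  obtain ⟨s, -, rfl⟩ := hx
  obtain ⟨t, -, rfl⟩ := hy
  have key : ∀ r : ℝ, (conj w * (a + r • (b - a))).im
      = (conj w * a).im + r * (conj w * (b - a)).im := by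
    intro r; simp; ring
  simp only [key, add_right_inj, mul_eq_mul_right_iff, hw, or_false] at h
  rw [h]

/-- The points at which a trajectory unfolding to that of `p` may meet `KS_n`: the vertices, and
the transversal intersections with the sides. -/
def hittingPoints (n : ℕ) (p : ℂ × Circle) : Set ℂ :=
  ⋃ s ∈ kochSides n, ({s.1, s.2} ∪ ⋃ g ∈ dihedralThree,
    {x | x ∈ segment ℝ s.1 s.2 ∧ (conj (g p.2) * (s.2 - s.1)).im ≠ 0 ∧
      ∃ b ∈ grid n, ∃ T : ℝ, x = g (p.1 + T * p.2) + b})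

/-- The functional `x ↦ Im (conj w * x)` is constant along flights in direction `w` and injective on
transversal sides, so it suffices that it takes finitely many values. -/
theorem finite_hittingPoints (n : ℕ) {p : ℂ × Circle} (hp : IsRationalDirection p.2) :
    (hittingPoints n p).Finite := by
  refine (finite_kochSides n).biUnion fun s _ => (Set.toFinite {s.1, s.2}).union
    (finite_dihedralThree.biUnion fun g hg => ?_)
  obtain ⟨S, hS, hSm⟩ := hp
  have hbdd : Bornology.IsBounded (segment ℝ s.1 s.2) := by
    rw [segment_eq_image']
    exact (isCompact_Icc.image (by fun_prop)).isBounded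
  obtain ⟨M, hM⟩ := hbdd.exists_norm_le
  set w : ℂ := g p.2 with hw
  have hwn : ‖w‖ = 1 := by rw [hw, g.norm_map, Circle.norm_coe]
  set c₀ : ℝ := (conj w * g p.1).im with hc₀
  -- Both `S * w` and `3 ^ n * b` are Eisenstein integers, and imaginary parts of those are
  -- multiples of `√3 / 2`; so the values lie in `c₀ + κℤ`.
  set κ : ℝ := Real.sqrt 3 / 2 / (S * 3 ^ n) with hκ
  have hκ0 : 0 < κ := by positivity
  refine Set.Finite.of_finite_image (f := fun x => (conj w * x).im) ?_ ?_
  · refine ((Set.finite_Icc (-⌈(M + |c₀|) / κ⌉) ⌈(M + |c₀|) / κ⌉).image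
      fun m : ℤ => c₀ + m * κ).subset ?_
    rintro _ ⟨x, ⟨hx, -, b, hb, T, hxb⟩, rfl⟩
    have hxn := hM x hx
    have him : (conj w * x).im = c₀ + (conj w * b).im := by
      rw [hxb, map_add, map_ofReal_mul, ← hw, mul_add, Complex.add_im,
        im_conj_mul_add_real_mul]
    have hmem : conj (S * w) * (3 ^ n * b) ∈ eisenstein := by
      refine mul_mem (conj_mem_eisenstein ?_) hb
      rw [hw, ← map_ofReal_mul]
      exact dihedralThree_apply_mem hg hSm
    obtain ⟨m, hm⟩ := im_eisenstein hmem
    have hm' : (conj w * b).im = m * κ := by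
      have : conj (S * w) * (3 ^ n * b) = ((S * 3 ^ n : ℝ) : ℂ) * (conj w * b) := by
        rw [map_mul, Complex.conj_ofReal]; push_cast; ring
      rw [this, Complex.im_ofReal_mul] at hm
      rw [hκ]; field_simp; linarith
    rw [hm'] at him
    have habs : |m * κ| ≤ M + |c₀| := by
      have h1 : |(conj w * x).im| ≤ M := by
        refine (Complex.abs_im_le_norm _).trans ?_
        rw [norm_mul, Complex.norm_conj, hwn, one_mul]
        exact hxn
      have h2 : (m * κ : ℝ) = (conj w * x).im - c₀ := by linarith
      rw [h2]
      exact (abs_sub _ _).trans (by linarith)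
    have hmle : |(m : ℝ)| ≤ (M + |c₀|) / κ := by
      rw [abs_mul, abs_of_pos hκ0] at habs
      exact (le_div_iff₀ hκ0).2 habs
    refine ⟨m, ?_, him.symm⟩
    have hceil := hmle.trans (Int.le_ceil _)
    have : |m| ≤ ⌈(M + |c₀|) / κ⌉ := by exact_mod_cast hceil
    exact ⟨(abs_le.1 this).1, (abs_le.1 this).2⟩
  · rintro x ⟨hx, hs, -⟩ y ⟨hy, -⟩ h
    exact eq_of_mem_segment_of_im_eq hs hx hy h

/-- From a point in the relative interior of a segment one can move a little in any parallel
direction without leaving the segment. -/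
theorem exists_mem_segment_of_parallel {a b x w : ℂ} (hab : b - a ≠ 0) (hx : x ∈ segment ℝ a b)
    (hxa : x ≠ a) (hxb : x ≠ b) (hw : (conj w * (b - a)).im = 0) {δ : ℝ} (hδ : 0 < δ) :
    ∃ s ∈ Set.Ioo 0 δ, x + (s : ℂ) * w ∈ segment ℝ a b := by
  rw [segment_eq_image'] at hx ⊢
  obtain ⟨t, ht, rfl⟩ := hx
  have ht0 : 0 < t := lt_of_le_of_ne ht.1 fun h => hxa (by simp [← h])
  have ht1 : t < 1 := lt_of_le_of_ne ht.2 fun h => hxb (by simp [h])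
  obtain ⟨r, hr⟩ : ∃ r : ℝ, w = r • (b - a) := by
    refine ⟨(conj w * (b - a)).re / ‖b - a‖ ^ 2, ?_⟩
    have hn : (‖b - a‖ : ℂ) ^ 2 ≠ 0 := by simpa using hab
    have h1 : (((conj w * (b - a)).re : ℝ) : ℂ) = w * conj (b - a) := by
      apply Complex.ext
      · simp; ring
      · rw [Complex.ofReal_im]
        simp at hw ⊢
        linarith
    rw [Complex.real_smul, Complex.ofReal_div, h1, Complex.ofReal_pow, div_mul_eq_mul_div,
      eq_div_iff hn, ← Complex.conj_mul']
    ring_nf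
  have hev : ∀ᶠ s : ℝ in nhdsWithin 0 (Set.Ioi 0), t + s * r ∈ Set.Ioo (0 : ℝ) 1 := by
    apply Filter.Eventually.filter_mono nhdsWithin_le_nhds
    have hc : Continuous fun s : ℝ => t + s * r := by fun_prop
    exact hc.continuousAt.eventually (Ioo_mem_nhds (by simpa using ht0) (by simpa using ht1))
  obtain ⟨s, hs, hsδ⟩ := (hev.and (Ioo_mem_nhdsGT hδ)).exists
  refine ⟨s, hsδ, t + s * r, ⟨hs.1.le, hs.2.le⟩, ?_⟩
  rw [hr]
  simp only [Complex.real_smul]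
  push_cast
  ring

/-- A flight parallel to a side through an interior point of it would run inside the curve,
contradicting free flight. The sign `σ` is `1` for a departing ball and `-1` for an arriving one
traced backwards. -/
theorem mem_hittingPoints_of_unfolds {n : ℕ} {p q : ℂ × Circle} {T t δ σ : ℝ}
    (h : Unfolds n T p q) (hmem : q.1 + t * q.2 ∈ kochCurve n) (hδ : 0 < δ)
    (hfree : ∀ s ∈ Set.Ioo 0 δ, (q.1 + t * q.2) + (s : ℂ) * (σ * q.2) ∉ kochCurve n) :
    q.1 + t * q.2 ∈ hittingPoints n p := by
  simp only [kochCurve, Set.mem_iUnion, not_exists] at hmem hfree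
  obtain ⟨s, hs, hxs⟩ := hmem
  simp only [hittingPoints, Set.mem_iUnion]
  refine ⟨s, hs, ?_⟩
  by_cases hend : q.1 + t * q.2 = s.1 ∨ q.1 + t * q.2 = s.2
  · exact Or.inl hend
  push Not at hend
  right
  obtain ⟨g, hg, b, hb, h1, h2⟩ := h
  simp only [Set.mem_iUnion]
  refine ⟨g, hg, hxs, fun hpar => ?_, b, hb, T + t, ?_⟩
  · have hpar' : (conj (σ * (q.2 : ℂ)) * (s.2 - s.1)).im = 0 := by
      rw [h1, map_mul, Complex.conj_ofReal, mul_assoc, Complex.im_ofReal_mul, hpar, mul_zero]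
    obtain ⟨r, hr, hmem⟩ := exists_mem_segment_of_parallel (side_ne hs) hxs hend.1 hend.2 hpar' hδ
    exact hfree r hr s hs hmem
  · rw [h2, h1, map_add, map_add, map_ofReal_mul, map_ofReal_mul]
    push_cast; ring

theorem BilliardMap.source_mem_hittingPoints {n : ℕ} {p q r : ℂ × Circle} {T : ℝ}
    (h : Unfolds n T p q) (hqr : BilliardMap n q r) : q.1 ∈ hittingPoints n p := by
  obtain ⟨hq, -, ⟨t, ht, -, -, hfree⟩, -⟩ := hqr
  have := mem_hittingPoints_of_unfolds (t := 0) (σ := 1) h (by simpa using hq.1) ht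
    (by simpa using hfree)
  simpa using this

theorem BilliardMap.target_mem_hittingPoints {n : ℕ} {p q r : ℂ × Circle} {T : ℝ}
    (h : Unfolds n T p q) (hqr : BilliardMap n q r) : r.1 ∈ hittingPoints n p := by
  obtain ⟨-, hr, ⟨t, ht, hy, -, hfree⟩, -⟩ := hqr
  rw [hy]
  refine mem_hittingPoints_of_unfolds (σ := -1) h (hy ▸ hr.1) ht fun s hs => ?_
  have := hfree (t - s) ⟨by linarith [hs.2], by linarith [hs.1]⟩
  convert this using 1
  push_cast; ring

theorem isClosedOrbit_of_isRationalDirection (n : ℕ) {p : ℂ × Circle}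
    (hp : IsRationalDirection p.2) : IsClosedOrbit n p := by
  have hdir : {φ : Circle | ∃ g ∈ dihedralThree, (φ : ℂ) = g p.2}.Finite := by
    refine Set.Finite.of_finite_image (f := fun φ : Circle => (φ : ℂ)) ?_
      Circle.coe_injective.injOn
    refine (finite_dihedralThree.image fun g => g (p.2 : ℂ)).subset ?_
    rintro _ ⟨φ, ⟨g, hg, h⟩, rfl⟩
    exact ⟨g, hg, h.symm⟩
  -- The point `p` is listed apart, since it may have no iterates. Any other point of the orbit is
  -- the target of a last step or the source of a first one.
  refine ((Set.finite_singleton p).union ((finite_hittingPoints n hp).prod hdir)).subset ?_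
  have hsnd : ∀ {T : ℝ} {q : ℂ × Circle}, Unfolds n T p q →
      ∃ g ∈ dihedralThree, (q.2 : ℂ) = g p.2 := fun h => by
    obtain ⟨g, hg, -, -, h1, -⟩ := h
    exact ⟨g, hg, h1⟩
  rintro q (hq | hq)
  · rcases Relation.ReflTransGen.cases_tail hq with rfl | ⟨r, hpr, hrq⟩
    · exact Or.inl rfl
    · obtain ⟨T, hT⟩ := unfolds_of_reflTransGen hpr
      obtain ⟨T', hT'⟩ := unfolds_of_reflTransGen hq
      exact Or.inr ⟨hrq.target_mem_hittingPoints hT, hsnd hT'⟩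
  · rcases Relation.ReflTransGen.cases_head hq with rfl | ⟨r, hqr, hrp⟩
    · exact Or.inl rfl
    · obtain ⟨T, hT⟩ := unfolds_of_reflTransGen hq
      exact Or.inr ⟨hqr.source_mem_hittingPoints hT.symm, hsnd hT.symm⟩

theorem mainTheorem3 (p : ℕ → ℂ × Circle) (hp : IsCompatibleSequence p)
    (h0 : IsClosedOrbit 0 (p 0)) : ∀ n : ℕ, IsClosedOrbit n (p n) := by
  intro n
  have hdir := isRationalDirection_of_isClosedOrbit_zero (hp 0).1 h0
  rw [← (hp n).2.1] at hdir
  exact isClosedOrbit_of_isRationalDirection n hdir
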